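/- Let $\mathbf M_0\in\mathbb R^{n\times n}$ be symmetric with $[\mathbf M_0]_{ij}\le 0$ for $i\ne j$ and $[\mathbf M_0]_{ii}\ge-\sum_{j\ne i}[\mathbf M_0]_{ij}$ for all $i$, viewed as the weighted Laplacian of the graph $\mathbb G$ on $\{v_1,\dots,v_n\}$ in which $v_i,v_j$ ($i\neq j$) are joined by an edge of weight $\mathbf W_{ij}=-[\mathbf M_0]_{ij}$ iff $\mathbf W_{ij}>0$. (This includes positive definite, i.e. SDDM, matrices and Laplacians with zero row sums.) Assume that $\mathbb G$ has at least one edge, and let $d_{\max}$ be its maximal degree and $\mathbf W_{\max},\mathbf W_{\min}$ its largest and smallest edge weights. For $1\le R\le n$ put $\alpha=\min\{n,\sum_{i=0}^{R}d_{\max}^{\,i}\}$; the sum equals $\frac{d_{\max}^{R+1}-1}{d_{\max}-1}$ if $d_{\max}\ne1$. There exist a decentralized algorithm and a universal constant $C$ with the following property. Let $n$, $R$, $\mathbf M_0$ be as above, let $\epsilon\in(0,\frac12]$, and let $\mathbf b_0\in\mathbb R^n$ be such that $\mathbf M_0\mathbf x=\mathbf b_0$ is solvable. The input of node $v_k$ is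 $n$, $k$, $R$, $\epsilon$, the $k$-th row of $\mathbf M_0$ and $[\mathbf b_0]_k$; nodes receive information only from nodes at distance at most $R$ in $\mathbb G$. After at most $$C\,\frac{n^3\alpha}{R}\,\frac{\mathbf W_{\max}}{\mathbf W_{\min}}\,\log\frac1\epsilon$$ time steps all nodes have halted, and node $v_k$ returns the component $\tilde x_k$ of a vector $\tilde{\mathbf x}$ that is an $\epsilon$-close solution, i.e. $\|\mathbf x^\star-\tilde{\mathbf x}\|_{\mathbf M_0}\le\epsilon\|\mathbf x^\star\|_{\mathbf M_0}$ for every solution $\mathbf x^\star$ of $\mathbf M_0\mathbf x=\mathbf b_0$, where $\|\mathbf u\|_{\mathbf M_0}^2=\mathbf u^{\mathsf T}\mathbf M_0\mathbf u$. Here all nodes are synchronous real random access machines running one common finite program, and in each time step a node performs one elementary operation: an arithmetic operation or a comparison, publishing one number, or receiving the number published by one node of its $R$-hop neighbourhood. -/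

import Mathlib

namespace RHop

/-! ### Weighted Laplacians, their graphs, and approximate solutions -/

/-- Symmetric diagonally dominant matrices with non-positive off-diagonal entries, i.e. the
matrices `M` that are read as the weighted Laplacian of a graph with edge weights `- M i j`.
Every such matrix is positive semidefinite. The class contains the positive definite ones (the
SDDM matrices) as well as the Laplacians with vanishing row sums. -/
structure IsWeightedLaplacian {n : ℕ} (M : Matrix (Fin n) (Fin n) ℝ) : Prop where
  symm : M.IsSymm
  offDiag_nonpos : ∀ i j, i ≠ j → M i j ≤ 0
  diagDominant : ∀ i, -∑ j ∈ Finset.univ.erase i, M i j ≤ M i i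

/-- The graph of `M`: distinct `i`, `j` are joined by an edge iff the weight `- M i j` is positive.
(For symmetric `M` the two inequalities are the same.) -/
def graph {n : ℕ} (M : Matrix (Fin n) (Fin n) ℝ) : SimpleGraph (Fin n) where
  Adj i j := i ≠ j ∧ 0 < -M i j ∧ 0 < -M j i
  symm := ⟨fun _ _ h => ⟨h.1.symm, h.2.2, h.2.1⟩⟩
  loopless := ⟨fun _ h => h.1 rfl⟩

/-- The finite set of edge weights. -/
def edgeWeights {n : ℕ} (M : Matrix (Fin n) (Fin n) ℝ) : Set ℝ :=
  {w | ∃ i j, (graph M).Adj i j ∧ w = -M i j}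

/-- The largest edge weight. -/
noncomputable def maxWeight {n : ℕ} (M : Matrix (Fin n) (Fin n) ℝ) : ℝ := sSup (edgeWeights M)

/-- The smallest edge weight. -/
noncomputable def minWeight {n : ℕ} (M : Matrix (Fin n) (Fin n) ℝ) : ℝ := sInf (edgeWeights M)

open Classical in
/-- The maximal degree of the graph of `M`. -/
noncomputable def maxDeg {n : ℕ} (M : Matrix (Fin n) (Fin n) ℝ) : ℕ := (graph M).maxDegree

/-- `α = min {n, 1 + d + d ^ 2 + ⋯ + d ^ R}` with `d` the maximal degree. The sum is
`(d ^ (R + 1) - 1) / (d - 1)` for `d ≠ 1`. -/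
noncomputable def hopBound {n : ℕ} (M : Matrix (Fin n) (Fin n) ℝ) (R : ℕ) : ℕ :=
  min n (∑ i ∈ Finset.range (R + 1), maxDeg M ^ i)

/-- `‖u‖_M = √(uᵀ M u)`. -/
noncomputable def energyNorm {n : ℕ} (M : Matrix (Fin n) (Fin n) ℝ) (u : Fin n → ℝ) : ℝ :=
  Real.sqrt (u ⬝ᵥ M.mulVec u)

/-- `x` is `ε`-close to the solution of `M y = b`. If `M` is singular, the condition is the same
for every choice of the solution `y`. -/
def IsApproxSolution {n : ℕ} (M : Matrix (Fin n) (Fin n) ℝ) (b : Fin n → ℝ) (ε : ℝ)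
    (x : Fin n → ℝ) : Prop :=
  ∀ y : Fin n → ℝ, M.mulVec y = b → energyNorm M (y - x) ≤ ε * energyNorm M y

/-! ### Programs

Every node is a real random access machine with index registers (natural numbers) and
two-dimensional arrays of real numbers, and with one outgoing real number that the nodes in its
`R`-hop neighbourhood can receive. All nodes run the same finite program. -/

/-- A cell of an array: the name of the array, and the names of the two index registers that hold
the row and the column. -/
structure Cell where
  arr : ℕ
  row : ℕ
  col : ℕ

/-- Arithmetic operations on real numbers. -/
inductive Arith
  | add
  | sub
  | mul
  | div

/-- Elementary operations; each of them takes one time step. -/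
inductive Op
  /-- do nothing -/
  | nop
  /-- index register `x` becomes the numeral `c` -/
  | idxConst (x c : ℕ)
  /-- index register `x` becomes the sum of the registers `y` and `z` -/
  | idxAdd (x y z : ℕ)
  /-- index register `x` becomes the truncated difference of the registers `y` and `z` -/
  | idxSub (x y z : ℕ)
  /-- the index register `y` is copied into a real cell -/
  | ofIdx (p : Cell) (y : ℕ)
  /-- a real cell is copied -/
  | copy (p q : Cell)
  /-- the result of an arithmetic operation on the cells `q` and `r` is stored in `p` -/
  | arith (p : Cell) (o : Arith) (q r : Cell)
  /-- the content of the cell `q` becomes the outgoing number of the node -/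
  | send (q : Cell)
  /-- the outgoing number of the single node whose name is in the index register `y` is received
  and stored in `p` -/
  | recv (p : Cell) (y : ℕ)

/-- Tests for branches and loops. -/
inductive Test
  | idxLt (x y : ℕ)
  | idxEq (x y : ℕ)
  | realLt (p q : Cell)
  | realEq (p q : Cell)

/-- Programs. -/
inductive Cmd
  | op (o : Op)
  | seq (c₁ c₂ : Cmd)
  | ite (t : Test) (c₁ c₂ : Cmd)
  | loop (t : Test) (c : Cmd)

/-! ### Execution of one node -/

/-- The state of a node: the stack of the commands still to be executed, the index registers, the
real arrays and the outgoing number. -/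
structure Node where
  code : List Cmd
  idx : ℕ → ℕ
  mem : ℕ → ℕ → ℕ → ℝ
  out : ℝ

/-- The content of a cell. -/
def Node.get (s : Node) (p : Cell) : ℝ := s.mem p.arr (s.idx p.row) (s.idx p.col)

/-- Overwrite an index register. -/
def Node.setIdx (s : Node) (x v : ℕ) : Node := { s with idx := Function.update s.idx x v }

open Classical in
/-- Overwrite a cell. -/
noncomputable def Node.put (s : Node) (p : Cell) (v : ℝ) : Node :=
  { s with mem := fun a i j =>
      if a = p.arr ∧ i = s.idx p.row ∧ j = s.idx p.col then v else s.mem a i j }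

/-- The arithmetic operations (division by zero returns zero). -/
noncomputable def Arith.eval : Arith → ℝ → ℝ → ℝ
  | .add, x, y => x + y
  | .sub, x, y => x - y
  | .mul, x, y => x * y
  | .div, x, y => x / y

/-- The truth of a test at a node. -/
def Test.holds : Test → Node → Prop
  | .idxLt x y, s => s.idx x < s.idx y
  | .idxEq x y, s => s.idx x = s.idx y
  | .realLt p q, s => s.get p < s.get q
  | .realEq p q, s => s.get p = s.get q

/-- The effect of an elementary operation at a node; `inbox j` is the number that the node receives
if it asks for the outgoing number of the node with name `j`. -/
noncomputable def Op.exec (inbox : ℕ → ℝ) : Op → Node → Node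
  | .nop, s => s
  | .idxConst x c, s => s.setIdx x c
  | .idxAdd x y z, s => s.setIdx x (s.idx y + s.idx z)
  | .idxSub x y z, s => s.setIdx x (s.idx y - s.idx z)
  | .ofIdx p y, s => s.put p (s.idx y : ℝ)
  | .copy p q, s => s.put p (s.get q)
  | .arith p o q r, s => s.put p (o.eval (s.get q) (s.get r))
  | .send q, s => { s with out := s.get q }
  | .recv p y, s => s.put p (inbox (s.idx y))

open Classical in
/-- One time step of a node. Elementary operations, the evaluation of a test, and the unfolding of
a sequence take one step each. A node that has nothing left to execute has halted and does not
change any more. -/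
noncomputable def Node.step (inbox : ℕ → ℝ) (s : Node) : Node :=
  match s.code with
  | [] => s
  | .op o :: k => o.exec inbox { s with code := k }
  | .seq c₁ c₂ :: k => { s with code := c₁ :: c₂ :: k }
  | .ite t c₁ c₂ :: k => if t.holds s then { s with code := c₁ :: k } else { s with code := c₂ :: k }
  | .loop t c :: k =>
      if t.holds s then { s with code := c :: .loop t c :: k } else { s with code := k }

/-- The node has finished its program. -/
def Node.Halted (s : Node) : Prop := s.code = []

/-! ### The network -/

open Classical in
/-- What the node `k` receives from the node named `j`: the outgoing number of `j` if `j` belongs to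
the `R`-hop neighbourhood of `k` in `G`, and zero otherwise. The extended distance is used, so
nodes in different components never communicate. -/
noncomputable def inbox {n : ℕ} (G : SimpleGraph (Fin n)) (R : ℕ) (σ : Fin n → Node) (k : Fin n)
    (j : ℕ) : ℝ :=
  if h : j < n then (if G.edist k ⟨j, h⟩ ≤ (R : ℕ∞) then (σ ⟨j, h⟩).out else 0) else 0

/-- One step of the global clock: all nodes make one step simultaneously, and what they receive are
the outgoing numbers before the step. -/
noncomputable def netStep {n : ℕ} (G : SimpleGraph (Fin n)) (R : ℕ) (σ : Fin n → Node) :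
    Fin n → Node :=
  fun k => (σ k).step (inbox G R σ k)

/-- The initial state of a node with name `k` whose input is `n`, `k`, `R` (index registers
`0`, `1`, `2`), the row `row` of the matrix (array `0`, row `0`), the component `bk` of the right-hand
side (array `1`) and the precision `ε` (array `2`). Everything else is zero. -/
noncomputable def initNode (P : Cmd) {n : ℕ} (R : ℕ) (ε : ℝ) (k : Fin n) (row : Fin n → ℝ)
    (bk : ℝ) : Node where
  code := [P]
  idx x := match x with
    | 0 => n
    | 1 => k
    | 2 => R
    | _ => 0
  mem a i j := match a, i with
    | 0, 0 => if h : j < n then row ⟨j, h⟩ else 0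
    | 1, 0 => if j = 0 then bk else 0
    | 2, 0 => if j = 0 then ε else 0
    | _, _ => 0
  out := 0

/-- The state of the network after `T` time steps, if every node `k` runs `P` on the `k`-th row of
`M`, the component `b k`, `R` and `ε`. -/
noncomputable def run (P : Cmd) {n : ℕ} (M : Matrix (Fin n) (Fin n) ℝ) (b : Fin n → ℝ) (R : ℕ)
    (ε : ℝ) (T : ℕ) : Fin n → Node :=
  (netStep (graph M) R)^[T] (fun k => initNode P R ε k (M k) (b k))

/-- The number that a node returns (array `3`, row `0`, column `0`). -/
def Node.result (s : Node) : ℝ := s.mem 3 0 0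

end RHop

/-! The bound leaves room for an exact solver. An edge forces `d_max ≥ 1`, so `α ≥ R` because `R ≤
n`; the ratio of weights is at least 1, and `log (1/ε) ≥ log 2`. Hence the bound dominates a
constant times `n ^ 3` (`cube_le_bound`), and it suffices to solve the system exactly in `O(n ^ 3)`
steps, by distributed Gauss–Jordan elimination.

No pivoting is needed (`Eliminated.step`): the rows not yet used form a Schur complement, which
again is symmetric with non-positive off-diagonal entries and non-negative row sums. A vanishing
pivot therefore has a vanishing row, and that step changes nothing. Fill-in joins only nodes of one
connected component, so every node that needs the pivot row can be reached from the pivot node.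

For each pivot, a breadth-first search of `n` rounds, each polling all `n` names, yields a tree
(`hoare_search`). Each of the `n + 1` entries of the augmented pivot row then travels down this tree
in `n` rounds (`hoare_broadcast`). This is `O(n ^ 2)` per pivot. Since all nodes stay in lockstep,
the network is verified like one sequential program, by Hoare triples that also count time. -/

namespace RHop

/-! ### Lockstep execution

All nodes execute the same commands at the same time; a configuration with common stack `K` is
`withCode σ K`. -/

/-- Give all nodes the stack `K`. -/
def withCode {n : ℕ} (σ : Fin n → Node) (K : List Cmd) : Fin n → Node :=
  fun k => { σ k with code := K }

/-- From every configuration with `P`, all nodes execute `c` in lockstep within `B` time steps,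
which leads to a configuration with `Q`. -/
def Lockstep {n : ℕ} (G : SimpleGraph (Fin n)) (R : ℕ) (P : (Fin n → Node) → Prop) (c : Cmd)
    (B : ℕ) (Q : (Fin n → Node) → Prop) : Prop :=
  ∀ σ, P σ → ∃ T ≤ B, ∃ σ', Q σ' ∧
    ∀ K, (netStep G R)^[T] (withCode σ (c :: K)) = withCode σ' K

theorem Op.exec_code (ib : ℕ → ℝ) (o : Op) (s : Node) (K : List Cmd) :
    o.exec ib { s with code := K } = { o.exec ib s with code := K } := by
  cases o <;> rfl

theorem Test.holds_code (t : Test) (s : Node) (K : List Cmd) :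
    t.holds { s with code := K } ↔ t.holds s := by
  cases t <;> rfl

theorem netStep_op {n : ℕ} (G : SimpleGraph (Fin n)) (R : ℕ) (σ : Fin n → Node) (o : Op)
    (K : List Cmd) :
    netStep G R (withCode σ (.op o :: K)) =
      withCode (fun k => o.exec (inbox G R σ k) (σ k)) K := by
  funext k
  exact Op.exec_code _ o (σ k) K

theorem netStep_seq {n : ℕ} (G : SimpleGraph (Fin n)) (R : ℕ) (σ : Fin n → Node) (c₁ c₂ : Cmd)
    (K : List Cmd) :
    netStep G R (withCode σ (.seq c₁ c₂ :: K)) = withCode σ (c₁ :: c₂ :: K) := rfl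

theorem netStep_loop {n : ℕ} (G : SimpleGraph (Fin n)) (R : ℕ) (σ : Fin n → Node) (t : Test)
    (c : Cmd) (K : List Cmd) (h : ∀ k, t.holds (σ k)) :
    netStep G R (withCode σ (.loop t c :: K)) = withCode σ (c :: .loop t c :: K) := by
  funext k
  exact if_pos ((t.holds_code (σ k) _).2 (h k))

theorem netStep_loop_exit {n : ℕ} (G : SimpleGraph (Fin n)) (R : ℕ) (σ : Fin n → Node) (t : Test)
    (c : Cmd) (K : List Cmd) (h : ∀ k, ¬ t.holds (σ k)) :
    netStep G R (withCode σ (.loop t c :: K)) = withCode σ K := by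
  funext k
  exact if_neg (fun h' => h k ((t.holds_code (σ k) _).1 h'))

-- Both branches are single operations, so nodes that branch differently are in step again after two
-- time units.
open Classical in
theorem netStep_ite {n : ℕ} (G : SimpleGraph (Fin n)) (R : ℕ) (σ : Fin n → Node) (t : Test)
    (o₁ o₂ : Op) (K : List Cmd) :
    netStep G R (netStep G R (withCode σ (.ite t (.op o₁) (.op o₂) :: K))) =
      withCode (fun k => if t.holds (σ k) then o₁.exec (inbox G R σ k) (σ k)
        else o₂.exec (inbox G R σ k) (σ k)) K := by
  have h : netStep G R (withCode σ (.ite t (.op o₁) (.op o₂) :: K)) =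
      fun k => { σ k with code := .op (if t.holds (σ k) then o₁ else o₂) :: K } := by
    funext k
    have hk : t.holds (withCode σ (.ite t (.op o₁) (.op o₂) :: K) k) ↔ t.holds (σ k) :=
      t.holds_code (σ k) _
    change (if _ then _ else _) = _
    by_cases ht : t.holds (σ k)
    · rw [if_pos (hk.2 ht), if_pos ht]; rfl
    · rw [if_neg (fun h' => ht (hk.1 h')), if_neg ht]; rfl
  rw [h]
  funext k
  refine (Op.exec_code (inbox G R σ k) (if t.holds (σ k) then o₁ else o₂) (σ k) K).trans ?_
  by_cases ht : t.holds (σ k) <;> simp [withCode, ht]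

theorem Lockstep.op {n : ℕ} {G : SimpleGraph (Fin n)} {R : ℕ} {P Q : (Fin n → Node) → Prop}
    {o : Op} (h : ∀ σ, P σ → Q (fun k => o.exec (inbox G R σ k) (σ k))) :
    Lockstep G R P (.op o) 1 Q :=
  fun σ hσ => ⟨1, le_rfl, _, h σ hσ, fun K => netStep_op G R σ o K⟩

open Classical in
theorem Lockstep.ite {n : ℕ} {G : SimpleGraph (Fin n)} {R : ℕ} {P Q : (Fin n → Node) → Prop}
    {t : Test} {o₁ o₂ : Op}
    (h : ∀ σ, P σ → Q (fun k => if t.holds (σ k) then o₁.exec (inbox G R σ k) (σ k)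
        else o₂.exec (inbox G R σ k) (σ k))) :
    Lockstep G R P (.ite t (.op o₁) (.op o₂)) 2 Q :=
  fun σ hσ => ⟨2, le_rfl, _, h σ hσ, fun K => netStep_ite G R σ t o₁ o₂ K⟩

theorem Lockstep.seq {n : ℕ} {G : SimpleGraph (Fin n)} {R : ℕ} {P Q S : (Fin n → Node) → Prop}
    {c₁ c₂ : Cmd} {B₁ B₂ : ℕ} (h₁ : Lockstep G R P c₁ B₁ Q) (h₂ : Lockstep G R Q c₂ B₂ S) :
    Lockstep G R P (.seq c₁ c₂) (B₂ + (B₁ + 1)) S := by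
  intro σ hσ
  obtain ⟨T₁, hT₁, σ₁, hσ₁, e₁⟩ := h₁ σ hσ
  obtain ⟨T₂, hT₂, σ₂, hσ₂, e₂⟩ := h₂ σ₁ hσ₁
  refine ⟨T₂ + (T₁ + 1), by omega, σ₂, hσ₂, fun K => ?_⟩
  rw [Function.iterate_add_apply, Function.iterate_succ_apply, netStep_seq, e₁, e₂]

/-- All nodes agree on each test, hence leave together. Each pass pays one step for its test, and
the last `+ 1` is the failing test. -/
theorem Lockstep.loop {n : ℕ} {G : SimpleGraph (Fin n)} {R : ℕ}
    (I : ℕ → (Fin n → Node) → Prop) (N : ℕ) {t : Test} {c : Cmd} {B : ℕ}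
    (ht : ∀ i ≤ N, ∀ σ, I i σ → ∀ k, t.holds (σ k) ↔ i < N)
    (hc : ∀ i < N, Lockstep G R (I i) c B (I (i + 1))) :
    Lockstep G R (I 0) (.loop t c) (N * (B + 1) + 1) (I N) := by
  suffices h : ∀ m i, i + m = N → Lockstep G R (I i) (.loop t c) (m * (B + 1) + 1) (I N) from
    h N 0 (by omega)
  intro m
  induction m with
  | zero =>
    rintro i hi σ hσ
    obtain rfl : i = N := by omega
    refine ⟨1, by omega, σ, hσ, fun K => netStep_loop_exit G R σ t c K fun k hk => ?_⟩
    exact lt_irrefl _ ((ht i le_rfl σ hσ k).1 hk)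
  | succ m ih =>
    intro i hi σ hσ
    obtain ⟨T₁, hT₁, σ₁, hσ₁, e₁⟩ := hc i (by omega) σ hσ
    obtain ⟨T₂, hT₂, σ₂, hσ₂, e₂⟩ := ih (i + 1) (by omega) σ₁ hσ₁
    refine ⟨T₂ + (T₁ + 1), by rw [Nat.succ_mul]; omega, σ₂, hσ₂, fun K => ?_⟩
    rw [Function.iterate_add_apply, Function.iterate_succ_apply,
      netStep_loop G R σ t c K fun k => (ht i (by omega) σ hσ k).2 (by omega), e₁, e₂]

theorem Lockstep.consequence {n : ℕ} {G : SimpleGraph (Fin n)} {R : ℕ}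
    {P P' Q Q' : (Fin n → Node) → Prop} {c : Cmd} {B B' : ℕ} (h : Lockstep G R P' c B Q')
    (hP : ∀ σ, P σ → P' σ) (hQ : ∀ σ, Q' σ → Q σ) (hB : B ≤ B') : Lockstep G R P c B' Q := by
  intro σ hσ
  obtain ⟨T, hT, σ', hσ', e⟩ := h σ (hP σ hσ)
  exact ⟨T, hT.trans hB, σ', hQ σ' hσ', e⟩

/-! ### The variables of the elimination program -/

/-- The values of the program variables: the loop counters, which are common to all nodes, and for
every node the parent in the broadcast tree, the current augmented row, the flag of the search, the
number received in the search, the broadcast number, the multiplier, the product of the last two,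
and the outgoing number. -/
structure Vars (n : ℕ) where
  piv : ℕ
  round : ℕ
  scan : ℕ
  col : ℕ
  par : Fin n → ℕ
  row : Fin n → ℕ → ℝ
  flag : Fin n → ℝ
  recd : Fin n → ℝ
  val : Fin n → ℝ
  mult : Fin n → ℝ
  prod : Fin n → ℝ
  out : Fin n → ℝ

/-- The node `s` with name `k` stores the values `S`. -/
structure NodeStores {n : ℕ} (S : Vars n) (k : Fin n) (s : Node) : Prop where
  size : s.idx 0 = n
  name : s.idx 1 = k
  zero : s.idx 3 = 0
  one : s.idx 4 = 1
  piv : s.idx 5 = S.piv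
  round : s.idx 6 = S.round
  scan : s.idx 7 = S.scan
  par : s.idx 8 = S.par k
  col : s.idx 9 = S.col
  width : s.idx 10 = n + 1
  row : ∀ c, s.mem 0 0 c = S.row k c
  flag : s.mem 4 0 0 = S.flag k
  recd : s.mem 5 0 0 = S.recd k
  val : s.mem 6 0 0 = S.val k
  mult : s.mem 7 0 0 = S.mult k
  prod : s.mem 8 0 0 = S.prod k
  out : s.out = S.out k

def Stores {n : ℕ} (S : Vars n) (σ : Fin n → Node) : Prop := ∀ k, NodeStores S k (σ k)

/-- The scalar variable kept in array `a`. -/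
abbrev scalar (a : ℕ) : Cell := ⟨a, 3, 3⟩

/-- The entry of the row in the column given by the index register `y`. -/
abbrev entry (y : ℕ) : Cell := ⟨0, 3, y⟩

open Classical in
/-- The number that node `k` receives from the node named `j`. -/
noncomputable def received {n : ℕ} (G : SimpleGraph (Fin n)) (R : ℕ) (out : Fin n → ℝ) (k : Fin n)
    (j : ℕ) : ℝ :=
  if h : j < n then (if G.edist k ⟨j, h⟩ ≤ (R : ℕ∞) then out ⟨j, h⟩ else 0) else 0

theorem Stores.inbox {n : ℕ} {S : Vars n} {σ : Fin n → Node} (h : Stores S σ)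
    (G : SimpleGraph (Fin n)) (R : ℕ) (k : Fin n) (j : ℕ) :
    inbox G R σ k j = received G R S.out k j := by
  simp only [RHop.inbox, received, (h _).out]

/-- `Lockstep` for assertions about the program variables. -/
def Hoare {n : ℕ} (G : SimpleGraph (Fin n)) (R : ℕ) (P : Vars n → Prop) (c : Cmd) (B : ℕ)
    (Q : Vars n → Prop) : Prop :=
  Lockstep G R (fun σ => ∃ S, Stores S σ ∧ P S) c B (fun σ => ∃ S, Stores S σ ∧ Q S)

/-- The precondition is obtained from `Q` by substitution, so chaining such triples with `Hoare.seq`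
leaves one implication about the composed update. -/
theorem Hoare.op {n : ℕ} {G : SimpleGraph (Fin n)} {R : ℕ} {o : Op} {f : Vars n → Vars n}
    (h : ∀ S σ, Stores S σ → Stores (f S) (fun k => o.exec (inbox G R σ k) (σ k)))
    {Q : Vars n → Prop} : Hoare G R (fun S => Q (f S)) (.op o) 1 Q :=
  Lockstep.op fun σ ⟨S, hS, hQ⟩ => ⟨f S, h S σ hS, hQ⟩

open Classical in
theorem Hoare.ite {n : ℕ} {G : SimpleGraph (Fin n)} {R : ℕ} {t : Test} {o₁ o₂ : Op}
    {f : Vars n → Vars n}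
    (h : ∀ S σ, Stores S σ → Stores (f S) (fun k => if t.holds (σ k)
      then o₁.exec (inbox G R σ k) (σ k) else o₂.exec (inbox G R σ k) (σ k)))
    {Q : Vars n → Prop} : Hoare G R (fun S => Q (f S)) (.ite t (.op o₁) (.op o₂)) 2 Q :=
  Lockstep.ite fun σ ⟨S, hS, hQ⟩ => ⟨f S, h S σ hS, hQ⟩

theorem Hoare.seq {n : ℕ} {G : SimpleGraph (Fin n)} {R : ℕ} {P Q S : Vars n → Prop}
    {c₁ c₂ : Cmd} {B₁ B₂ : ℕ} (h₁ : Hoare G R P c₁ B₁ Q) (h₂ : Hoare G R Q c₂ B₂ S) :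
    Hoare G R P (.seq c₁ c₂) (B₂ + (B₁ + 1)) S :=
  Lockstep.seq h₁ h₂

theorem Hoare.consequence {n : ℕ} {G : SimpleGraph (Fin n)} {R : ℕ}
    {P P' Q Q' : Vars n → Prop} {c : Cmd} {B B' : ℕ} (h : Hoare G R P' c B Q')
    (hP : ∀ S, P S → P' S) (hQ : ∀ S, Q' S → Q S) (hB : B ≤ B') : Hoare G R P c B' Q :=
  Lockstep.consequence h (fun _ ⟨S, hS, h⟩ => ⟨S, hS, hP S h⟩)
    (fun _ ⟨S, hS, h⟩ => ⟨S, hS, hQ S h⟩) hB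

theorem Hoare.pre {n : ℕ} {G : SimpleGraph (Fin n)} {R : ℕ}
    {P P' Q : Vars n → Prop} {c : Cmd} {B : ℕ} (h : Hoare G R P' c B Q)
    (hP : ∀ S, P S → P' S) : Hoare G R P c B Q :=
  h.consequence hP (fun _ h => h) le_rfl

/-- Fixes ghost values, such as the rows before a step, to which the postcondition refers. -/
theorem Hoare.exists {n : ℕ} {G : SimpleGraph (Fin n)} {R : ℕ} {ι : Sort*}
    {P : ι → Vars n → Prop} {Q : Vars n → Prop} {c : Cmd} {B : ℕ}
    (h : ∀ i, Hoare G R (P i) c B Q) : Hoare G R (fun S => ∃ i, P i S) c B Q :=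
  fun σ ⟨S, hS, i, hP⟩ => h i σ ⟨S, hS, hP⟩

/-- Loops whose test compares two index registers with common values. -/
theorem Hoare.loop {n : ℕ} {G : SimpleGraph (Fin n)} {R : ℕ} (I : ℕ → Vars n → Prop) (N : ℕ)
    {x y : ℕ} {c : Cmd} {B : ℕ}
    (ht : ∀ i S, I i S → ∀ k s, NodeStores S k s → s.idx x = i ∧ s.idx y = N)
    (hc : ∀ i < N, Hoare G R (I i) c B (I (i + 1))) :
    Hoare G R (I 0) (.loop (.idxLt x y) c) (N * (B + 1) + 1) (I N) := by
  refine Lockstep.loop (fun i σ => ∃ S, Stores S σ ∧ I i S) N ?_ hc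
  rintro i - σ ⟨S, hS, hI⟩ k
  obtain ⟨h₁, h₂⟩ := ht i S hI k _ (hS k)
  simp [Test.holds, h₁, h₂]

/-! ### Effects of the elementary operations on the variables -/

section Effects

variable {n : ℕ} {G : SimpleGraph (Fin n)} {R : ℕ} {Q : Vars n → Prop}

/-- Register `3` always holds 0, so adding it copies an index register. -/
theorem hoare_par_self :
    Hoare G R (fun S => Q { S with par := fun k => k }) (.op (.idxAdd 8 1 3)) 1 Q :=
  Hoare.op fun S σ h k => by
    obtain ⟨_, _, _, _, _, _, _, _, _, _, _, _, _, _, _, _, _⟩ := h k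
    constructor <;> simp [Op.exec, Node.setIdx, *]

open Classical in
theorem hoare_flag_init :
    Hoare G R (fun S => Q { S with flag := fun k => if (k : ℕ) = S.piv then 1 else 0 })
      (.ite (.idxEq 1 5) (.op (.ofIdx (scalar 4) 4)) (.op (.ofIdx (scalar 4) 3))) 2 Q :=
  Hoare.ite fun S σ h k => by
    obtain ⟨_, _, _, _, _, _, _, _, _, _, _, _, _, _, _, _, _⟩ := h k
    by_cases hk : (k : ℕ) = S.piv <;> constructor <;> simp [Op.exec, Node.put, Test.holds, *]

theorem hoare_round_init :
    Hoare G R (fun S => Q { S with round := 0 }) (.op (.idxConst 6 0)) 1 Q :=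
  Hoare.op fun S σ h k => by
    obtain ⟨_, _, _, _, _, _, _, _, _, _, _, _, _, _, _, _, _⟩ := h k
    constructor <;> simp [Op.exec, Node.setIdx, *]

theorem hoare_round_succ :
    Hoare G R (fun S => Q { S with round := S.round + 1 }) (.op (.idxAdd 6 6 4)) 1 Q :=
  Hoare.op fun S σ h k => by
    obtain ⟨_, _, _, _, _, _, _, _, _, _, _, _, _, _, _, _, _⟩ := h k
    constructor <;> simp [Op.exec, Node.setIdx, *]

theorem hoare_scan_init :
    Hoare G R (fun S => Q { S with scan := 0 }) (.op (.idxConst 7 0)) 1 Q :=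
  Hoare.op fun S σ h k => by
    obtain ⟨_, _, _, _, _, _, _, _, _, _, _, _, _, _, _, _, _⟩ := h k
    constructor <;> simp [Op.exec, Node.setIdx, *]

theorem hoare_scan_succ :
    Hoare G R (fun S => Q { S with scan := S.scan + 1 }) (.op (.idxAdd 7 7 4)) 1 Q :=
  Hoare.op fun S σ h k => by
    obtain ⟨_, _, _, _, _, _, _, _, _, _, _, _, _, _, _, _, _⟩ := h k
    constructor <;> simp [Op.exec, Node.setIdx, *]

theorem hoare_col_init :
    Hoare G R (fun S => Q { S with col := 0 }) (.op (.idxConst 9 0)) 1 Q :=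
  Hoare.op fun S σ h k => by
    obtain ⟨_, _, _, _, _, _, _, _, _, _, _, _, _, _, _, _, _⟩ := h k
    constructor <;> simp [Op.exec, Node.setIdx, *]

theorem hoare_col_piv :
    Hoare G R (fun S => Q { S with col := S.piv }) (.op (.idxAdd 9 5 3)) 1 Q :=
  Hoare.op fun S σ h k => by
    obtain ⟨_, _, _, _, _, _, _, _, _, _, _, _, _, _, _, _, _⟩ := h k
    constructor <;> simp [Op.exec, Node.setIdx, *]

theorem hoare_col_succ :
    Hoare G R (fun S => Q { S with col := S.col + 1 }) (.op (.idxAdd 9 9 4)) 1 Q :=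
  Hoare.op fun S σ h k => by
    obtain ⟨_, _, _, _, _, _, _, _, _, _, _, _, _, _, _, _, _⟩ := h k
    constructor <;> simp [Op.exec, Node.setIdx, *]

theorem hoare_piv_succ :
    Hoare G R (fun S => Q { S with piv := S.piv + 1 }) (.op (.idxAdd 5 5 4)) 1 Q :=
  Hoare.op fun S σ h k => by
    obtain ⟨_, _, _, _, _, _, _, _, _, _, _, _, _, _, _, _, _⟩ := h k
    constructor <;> simp [Op.exec, Node.setIdx, *]

theorem hoare_send_flag :
    Hoare G R (fun S => Q { S with out := S.flag }) (.op (.send (scalar 4))) 1 Q :=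
  Hoare.op fun S σ h k => by
    obtain ⟨_, _, _, _, _, _, _, _, _, _, _, _, _, _, _, _, _⟩ := h k
    constructor <;> simp [Op.exec, Node.get, *]

theorem hoare_send_val :
    Hoare G R (fun S => Q { S with out := S.val }) (.op (.send (scalar 6))) 1 Q :=
  Hoare.op fun S σ h k => by
    obtain ⟨_, _, _, _, _, _, _, _, _, _, _, _, _, _, _, _, _⟩ := h k
    constructor <;> simp [Op.exec, Node.get, *]

theorem hoare_recv_flag :
    Hoare G R (fun S => Q { S with recd := fun k => received G R S.out k S.scan })
      (.op (.recv (scalar 5) 7)) 1 Q :=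
  Hoare.op fun S σ h k => by
    have hb := h.inbox G R k
    obtain ⟨_, _, _, _, _, _, _, _, _, _, _, _, _, _, _, _, _⟩ := h k
    constructor <;> simp [Op.exec, Node.put, *]

theorem hoare_recv_val :
    Hoare G R (fun S => Q { S with val := fun k => received G R S.out k (S.par k) })
      (.op (.recv (scalar 6) 8)) 1 Q :=
  Hoare.op fun S σ h k => by
    have hb := h.inbox G R k
    obtain ⟨_, _, _, _, _, _, _, _, _, _, _, _, _, _, _, _, _⟩ := h k
    constructor <;> simp [Op.exec, Node.put, *]

-- Adopting a parent and raising the flag are separate branches with the same test. The parent comes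
-- first, because copying the received number into the flag makes the test fail.
open Classical in
theorem hoare_par_update :
    Hoare G R (fun S => Q { S with
        par := fun k => if S.flag k < S.recd k then S.scan else S.par k })
      (.ite (.realLt (scalar 4) (scalar 5)) (.op (.idxAdd 8 7 3)) (.op .nop)) 2 Q :=
  Hoare.ite fun S σ h k => by
    obtain ⟨_, _, _, _, _, _, _, _, _, _, _, _, _, _, _, _, _⟩ := h k
    by_cases hk : S.flag k < S.recd k <;> constructor <;>
      simp [Op.exec, Node.setIdx, Test.holds, Node.get, *]

open Classical in
theorem hoare_flag_update :
    Hoare G R (fun S => Q { S with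
        flag := fun k => if S.flag k < S.recd k then S.recd k else S.flag k })
      (.ite (.realLt (scalar 4) (scalar 5)) (.op (.copy (scalar 4) (scalar 5))) (.op .nop)) 2 Q :=
  Hoare.ite fun S σ h k => by
    obtain ⟨_, _, _, _, _, _, _, _, _, _, _, _, _, _, _, _, _⟩ := h k
    by_cases hk : S.flag k < S.recd k <;> constructor <;>
      simp [Op.exec, Node.put, Test.holds, Node.get, *]

open Classical in
theorem hoare_val_init :
    Hoare G R (fun S => Q { S with
        val := fun k => if (k : ℕ) = S.piv then S.row k S.col else S.val k })
      (.ite (.idxEq 1 5) (.op (.copy (scalar 6) (entry 9))) (.op .nop)) 2 Q :=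
  Hoare.ite fun S σ h k => by
    obtain ⟨_, _, _, _, _, _, _, _, _, _, _, _, _, _, _, _, _⟩ := h k
    by_cases hk : (k : ℕ) = S.piv <;> constructor <;>
      simp [Op.exec, Node.put, Test.holds, Node.get, *]

open Classical in
theorem hoare_mult :
    Hoare G R (fun S => Q { S with
        mult := fun k => if (k : ℕ) = S.piv then 0 else S.row k S.piv / S.val k })
      (.ite (.idxEq 1 5) (.op (.ofIdx (scalar 7) 3))
        (.op (.arith (scalar 7) .div (entry 5) (scalar 6)))) 2 Q :=
  Hoare.ite fun S σ h k => by
    obtain ⟨_, _, _, _, _, _, _, _, _, _, _, _, _, _, _, _, _⟩ := h k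
    by_cases hk : (k : ℕ) = S.piv <;> constructor <;>
      simp [Op.exec, Node.put, Test.holds, Node.get, Arith.eval, *]

theorem hoare_prod :
    Hoare G R (fun S => Q { S with prod := fun k => S.mult k * S.val k })
      (.op (.arith (scalar 8) .mul (scalar 7) (scalar 6))) 1 Q :=
  Hoare.op fun S σ h k => by
    obtain ⟨_, _, _, _, _, _, _, _, _, _, _, _, _, _, _, _, _⟩ := h k
    constructor <;> simp [Op.exec, Node.put, Node.get, Arith.eval, *]

theorem hoare_row_update :
    Hoare G R (fun S => Q { S with
        row := fun k => Function.update (S.row k) S.col (S.row k S.col - S.prod k) })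
      (.op (.arith (entry 9) .sub (entry 9) (scalar 8))) 1 Q :=
  Hoare.op fun S σ h k => by
    obtain ⟨_, _, _, _, _, _, _, _, _, _, _, _, _, _, _, _, _⟩ := h k
    constructor <;> simp [Op.exec, Node.put, Node.get, Arith.eval, Function.update_apply, *]

end Effects

/-! ### Gauss–Jordan elimination without pivoting -/

/-- The multiple of row `j` that is subtracted from row `k` in order to eliminate column `j`. It is
zero if the pivot vanishes. -/
noncomputable def multiplier {n : ℕ} (A : Fin n → Fin n → ℝ) (j k : Fin n) : ℝ :=
  if k = j then 0 else A k j / A j j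

/-- The state of the elimination of `M x = b` after the pivots with index less than `p`. -/
structure Eliminated {n : ℕ} (M : Matrix (Fin n) (Fin n) ℝ) (b : Fin n → ℝ) (p : ℕ)
    (A : Fin n → Fin n → ℝ) (v : Fin n → ℝ) : Prop where
  lower : ∀ k l : Fin n, p ≤ k → (l : ℕ) < p → A k l = 0
  symm : ∀ k l : Fin n, p ≤ k → p ≤ l → A k l = A l k
  nonpos : ∀ k l : Fin n, p ≤ k → k ≠ l → A k l ≤ 0
  rowSum : ∀ k : Fin n, p ≤ k → 0 ≤ ∑ l, A k l
  diag : ∀ k l : Fin n, (k : ℕ) < p → (l : ℕ) < p → k ≠ l → A k l = 0 ∨ A l l = 0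
  zeroRow : ∀ k l : Fin n, (k : ℕ) < p → A k k = 0 → A k l = 0
  sol : ∀ x : Fin n → ℝ, (∀ k, ∑ l, A k l * x l = v k) ↔ M.mulVec x = b
  comp : ∀ k l : Fin n, A k l ≠ 0 → (graph M).Reachable k l

theorem IsWeightedLaplacian.eliminated_zero {n : ℕ} {M : Matrix (Fin n) (Fin n) ℝ}
    (h : IsWeightedLaplacian M) (b : Fin n → ℝ) : Eliminated M b 0 M b where
  lower _ _ _ h := by omega
  symm k l _ _ := h.symm.apply l k
  nonpos k l _ hkl := h.offDiag_nonpos k l hkl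
  rowSum k _ := by
    have := h.diagDominant k
    rw [← Finset.add_sum_erase _ _ (Finset.mem_univ k)]
    linarith
  diag _ _ h := by omega
  zeroRow _ _ h := by omega
  sol x := by
    rw [funext_iff]
    rfl
  comp k l hkl := by
    by_cases e : k = l
    · rw [e]
    · have h₁ : 0 < -M k l := by
        have := lt_of_le_of_ne (h.offDiag_nonpos k l e) hkl
        linarith
      exact SimpleGraph.Adj.reachable (⟨e, h₁, by rwa [h.symm.apply k l]⟩ : (graph M).Adj k l)

/-- A row with vanishing pivot vanishes. -/
theorem Eliminated.row_eq_zero {n : ℕ} {M : Matrix (Fin n) (Fin n) ℝ} {b : Fin n → ℝ} {p : ℕ}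
    {A : Fin n → Fin n → ℝ} {v : Fin n → ℝ} (h : Eliminated M b p A v) {j : Fin n} (hj : p ≤ j)
    (h0 : A j j = 0) (l : Fin n) : A j l = 0 := by
  by_cases e : j = l
  · rw [← e, h0]
  have hn : ∀ i ∈ Finset.univ, A j i ≤ 0 := fun i _ => by
    by_cases e : j = i
    · rw [← e, h0]
    · exact h.nonpos j i hj e
  have hs : ∑ i, A j i = 0 := le_antisymm (Finset.sum_nonpos hn) (h.rowSum j hj)
  exact (Finset.sum_eq_zero_iff_of_nonpos hn).1 hs l (Finset.mem_univ l)

theorem Eliminated.pivot_nonneg {n : ℕ} {M : Matrix (Fin n) (Fin n) ℝ} {b : Fin n → ℝ} {p : ℕ}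
    {A : Fin n → Fin n → ℝ} {v : Fin n → ℝ} (h : Eliminated M b p A v) {j : Fin n} (hj : p ≤ j) :
    0 ≤ A j j := by
  have h₁ := h.rowSum j hj
  rw [← Finset.add_sum_erase _ _ (Finset.mem_univ j)] at h₁
  have h₂ : ∑ l ∈ Finset.univ.erase j, A j l ≤ 0 :=
    Finset.sum_nonpos fun l hl => h.nonpos j l hj (Finset.ne_of_mem_erase hl).symm
  linarith

/-- For rows below the pivot the multiplier is non-positive. Subtracting that multiple of row `j`
lowers off-diagonal entries and raises row sums, so the sign conditions survive. -/
theorem Eliminated.step {n : ℕ} {M : Matrix (Fin n) (Fin n) ℝ} {b : Fin n → ℝ} {j : Fin n}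
    {A : Fin n → Fin n → ℝ} {v : Fin n → ℝ} (h : Eliminated M b j A v) :
    Eliminated M b (j + 1) (fun k l => A k l - multiplier A j k * A j l)
      (fun k => v k - multiplier A j k * v j) := by
  have hz : ∀ k l : Fin n, A j j = 0 → A k l - multiplier A j k * A j l = A k l := by
    intro k l h0
    rw [h.row_eq_zero le_rfl h0, mul_zero, sub_zero]
  have hm : ∀ k : Fin n, (j : ℕ) + 1 ≤ k → multiplier A j k = A k j / A j j := fun k hk =>
    if_neg (by rintro rfl; omega)
  have hself : multiplier A j j = 0 := if_pos rfl
  have hcol : ∀ k : Fin n, k ≠ j → A j j ≠ 0 → A k j - multiplier A j k * A j j = 0 := by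
    intro k hk h0
    rw [multiplier, if_neg hk, div_mul_cancel₀ _ h0, sub_self]
  have hold : ∀ k l : Fin n, (l : ℕ) < j → A k l - multiplier A j k * A j l = A k l := by
    intro k l hl
    rw [h.lower j l le_rfl hl, mul_zero, sub_zero]
  have hmle : ∀ k : Fin n, (j : ℕ) + 1 ≤ k → multiplier A j k ≤ 0 := by
    intro k hk
    rw [hm k hk]
    exact div_nonpos_of_nonpos_of_nonneg (h.nonpos k j (by omega) (by rintro rfl; omega))
      (h.pivot_nonneg le_rfl)
  have hjcol : ∀ k : Fin n, (j : ℕ) + 1 ≤ k → A k j - multiplier A j k * A j j = 0 := by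
    intro k hk
    by_cases h0 : A j j = 0
    · rw [hz k j h0, h.symm k j (by omega) le_rfl, h.row_eq_zero le_rfl h0]
    · exact hcol k (by rintro rfl; omega) h0
  constructor
  · intro k l hk hl
    rcases Nat.lt_succ_iff_lt_or_eq.1 hl with hl | hl
    · exact (hold k l hl).trans (h.lower k l (by omega) hl)
    · obtain rfl : l = j := Fin.ext hl
      exact hjcol k hk
  · intro k l hk hl
    rw [hm k hk, hm l hl, h.symm k l (by omega) (by omega), h.symm j l le_rfl (by omega),
      h.symm j k le_rfl (by omega)]
    ring
  · intro k l hk hkl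
    have h₁ := h.nonpos k l (by omega) hkl
    by_cases hl : l = j
    · subst hl; exact (hjcol k hk).le
    · have h₂ := mul_nonneg_of_nonpos_of_nonpos (hmle k hk) (h.nonpos j l le_rfl (Ne.symm hl))
      linarith
  · intro k hk
    rw [Finset.sum_sub_distrib, ← Finset.mul_sum]
    have h₁ := h.rowSum k (by omega)
    have h₂ := mul_nonpos_of_nonpos_of_nonneg (hmle k hk) (h.rowSum j le_rfl)
    linarith
  -- A column with zero pivot is not cleared from earlier rows, hence the alternative `A l l = 0`.
  · intro k l hk hl hkl
    rcases Nat.lt_succ_iff_lt_or_eq.1 hl with hl | hl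
    · rw [hold k l hl, hold l l hl]
      rcases Nat.lt_succ_iff_lt_or_eq.1 hk with hk | hk
      · exact h.diag k l hk hl hkl
      · exact Or.inl (h.lower k l (by omega) hl)
    · obtain rfl : l = j := Fin.ext hl
      by_cases h0 : A l l = 0
      · right; rw [hz l l h0, h0]
      · exact Or.inl (hcol k hkl h0)
  · intro k l hk h0
    rcases Nat.lt_succ_iff_lt_or_eq.1 hk with hk | hk
    · rw [hold k k hk] at h0
      have hkj : A k j = 0 := h.zeroRow k j hk h0
      rw [h.zeroRow k l hk h0, multiplier, if_neg (by rintro rfl; omega), hkj, zero_div, zero_mul,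
        sub_zero]
    · obtain rfl : k = j := Fin.ext hk
      rw [hself, zero_mul, sub_zero] at h0 ⊢
      exact h.row_eq_zero le_rfl h0 l
  · intro x
    rw [← h.sol x]
    have hs : ∀ k, ∑ l, (A k l - multiplier A j k * A j l) * x l =
        ∑ l, A k l * x l - multiplier A j k * ∑ l, A j l * x l := by
      intro k
      rw [Finset.mul_sum, ← Finset.sum_sub_distrib]
      exact Finset.sum_congr rfl fun l _ => by ring
    simp only [hs]
    -- Row `j` itself is unchanged, so the row operations can be undone by adding its multiples
    -- back.
    refine ⟨fun hx => ?_, fun hx k => by rw [hx k, hx j]⟩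
    have hj := hx j
    rw [hself, zero_mul, zero_mul, sub_zero, sub_zero] at hj
    intro k
    have := hx k
    rw [hj] at this
    linarith
  · intro k l hkl
    -- Fill-in at `(k, l)` needs non-zero entries at `(k, j)` and `(j, l)`, which connect `k` to `l`
    -- through `j`.
    by_cases h₁ : A k l = 0
    · have h₂ : multiplier A j k ≠ 0 := by rintro e; simp [e, h₁] at hkl
      have h₃ : A j l ≠ 0 := by rintro e; simp [e, h₁] at hkl
      refine (h.comp k j ?_).trans (h.comp j l h₃)
      rintro e
      simp [multiplier, e] at h₂
    · exact h.comp k l h₁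

/-- After the elimination, the solution is read off from the diagonal. -/
theorem Eliminated.solution {n : ℕ} {M : Matrix (Fin n) (Fin n) ℝ} {b : Fin n → ℝ}
    {A : Fin n → Fin n → ℝ} {v : Fin n → ℝ} (h : Eliminated M b n A v)
    (hb : ∃ x : Fin n → ℝ, M.mulVec x = b) : M.mulVec (fun k => v k / A k k) = b := by
  rw [← h.sol]
  intro k
  by_cases h0 : A k k = 0
  -- The row vanishes, so solvability forces `v k = 0`.
  · obtain ⟨x, hx⟩ := hb
    have := (h.sol x).2 hx k
    rw [← this]
    simp [h.zeroRow k _ k.2 h0]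
  · rw [Finset.sum_eq_single k, mul_div_cancel₀ _ h0]
    -- An off-diagonal entry can survive only if `A l l = 0`, and then the unknown `v l / A l l` is
    -- 0 by the convention for division.
    · intro l _ hl
      rcases h.diag k l k.2 l.2 hl.symm with e | e <;> simp [e]
    · simp

theorem isApproxSolution_of_mulVec_eq {n : ℕ} {M : Matrix (Fin n) (Fin n) ℝ} {b x : Fin n → ℝ}
    {ε : ℝ} (hε : 0 ≤ ε) (h : M.mulVec x = b) : IsApproxSolution M b ε x := by
  intro y hy
  have : energyNorm M (y - x) = 0 := by
    rw [energyNorm, Matrix.mulVec_sub, hy, h, sub_self, dotProduct_zero, Real.sqrt_zero]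
  rw [this]
  exact mul_nonneg hε (Real.sqrt_nonneg _)

/-! ### The size of the time bound -/

/-- The set of edge weights is finite and nonempty, so its infimum is attained, hence positive. -/
theorem one_le_maxWeight_div_minWeight {n : ℕ} {M : Matrix (Fin n) (Fin n) ℝ}
    (h : ∃ i j, (graph M).Adj i j) : 1 ≤ maxWeight M / minWeight M := by
  obtain ⟨i, j, hij⟩ := h
  have hfin : (edgeWeights M).Finite := by
    refine (Set.finite_range fun q : Fin n × Fin n => -M q.1 q.2).subset ?_
    rintro w ⟨i, j, -, rfl⟩
    exact ⟨(i, j), rfl⟩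
  have hmem : -M i j ∈ edgeWeights M := ⟨i, j, hij, rfl⟩
  have hmin : minWeight M ∈ edgeWeights M := Set.Nonempty.csInf_mem ⟨_, hmem⟩ hfin
  have hpos : 0 < minWeight M := by
    obtain ⟨i, j, h, e⟩ := hmin
    rw [e]
    exact h.2.1
  rw [one_le_div hpos]
  exact le_csSup hfin.bddAbove hmin

theorem le_hopBound {n : ℕ} {M : Matrix (Fin n) (Fin n) ℝ} {R : ℕ}
    (h : ∃ i j, (graph M).Adj i j) (hR : R ≤ n) : R ≤ hopBound M R := by
  classical
  obtain ⟨i, j, hij⟩ := h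
  have hd : 1 ≤ maxDeg M := by
    have h₁ : 0 < (graph M).degree i := by
      rw [SimpleGraph.degree_pos_iff_exists_adj]
      exact ⟨j, hij⟩
    have h₂ : (graph M).degree i ≤ maxDeg M := by
      unfold maxDeg
      convert (graph M).degree_le_maxDegree i
    omega
  refine le_min hR ?_
  calc R ≤ ∑ i ∈ Finset.range (R + 1), 1 := by simp
    _ ≤ _ := Finset.sum_le_sum fun i _ => Nat.one_le_pow _ _ hd

theorem cube_le_bound {n R : ℕ} {M : Matrix (Fin n) (Fin n) ℝ} {ε : ℝ}
    (h : ∃ i j, (graph M).Adj i j) (hR : 1 ≤ R) (hRn : R ≤ n) (hε : 0 < ε) (hε' : ε ≤ 1 / 2) :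
    (n : ℝ) ^ 3 ≤ 2 * ((n : ℝ) ^ 3 * (hopBound M R : ℝ) / (R : ℝ) *
      (maxWeight M / minWeight M) * Real.log (1 / ε)) := by
  have h₁ : (n : ℝ) ^ 3 ≤ (n : ℝ) ^ 3 * (hopBound M R : ℝ) / (R : ℝ) := by
    rw [le_div_iff₀ (by exact_mod_cast hR)]
    have : (R : ℝ) ≤ hopBound M R := by exact_mod_cast le_hopBound h hRn
    gcongr
  have h₂ := one_le_maxWeight_div_minWeight h
  have h₃ : 1 / 2 ≤ Real.log (1 / ε) := by
    have h₄ : Real.log 2 ≤ Real.log (1 / ε) := by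
      refine Real.log_le_log (by norm_num) ?_
      rw [le_div_iff₀ hε]
      linarith
    linarith [Real.log_two_gt_d9]
  have h₅ : (n : ℝ) ^ 3 * 1 * (1 / 2) ≤ (n : ℝ) ^ 3 * (hopBound M R : ℝ) / (R : ℝ) *
      (maxWeight M / minWeight M) * Real.log (1 / ε) := by gcongr
  linarith

/-! ### Search from a node, and broadcast along the search tree -/

/-- The node `k` is at most `t` hops of length `R` away from `j`. -/
def InHops {n : ℕ} (G : SimpleGraph (Fin n)) (R : ℕ) (j : Fin n) : ℕ → Fin n → Prop
  | 0, k => k = j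
  | t + 1, k => ∃ i, G.edist k i ≤ (R : ℕ∞) ∧ InHops G R j t i

theorem InHops.succ {n : ℕ} {G : SimpleGraph (Fin n)} {R : ℕ} {j k : Fin n} {t : ℕ}
    (h : InHops G R j t k) : InHops G R j (t + 1) k :=
  ⟨k, by simp, h⟩

theorem InHops.mono {n : ℕ} {G : SimpleGraph (Fin n)} {R : ℕ} {j k : Fin n} {s t : ℕ}
    (h : InHops G R j s k) (hst : s ≤ t) : InHops G R j t k :=
  Nat.le_induction h (fun _ _ ih => ih.succ) t hst

theorem InHops.of_walk {n : ℕ} {G : SimpleGraph (Fin n)} {R : ℕ} (hR : 1 ≤ R) {j k : Fin n}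
    (w : G.Walk k j) : InHops G R j w.length k := by
  induction w with
  | nil => exact rfl
  | cons h p ih =>
    refine ⟨_, ?_, ih⟩
    rw [SimpleGraph.edist_eq_one_iff_adj.2 h]
    exact_mod_cast hR

/-- A path has fewer than `n` edges, and each edge is a hop; this is why `n` rounds suffice. -/
theorem InHops.of_reachable {n : ℕ} {G : SimpleGraph (Fin n)} {R : ℕ} (hR : 1 ≤ R) {j k : Fin n}
    (h : G.Reachable k j) : InHops G R j n k := by
  obtain ⟨w, hw⟩ := h.exists_isPath
  refine (InHops.of_walk hR w).mono ?_
  simpa using hw.length_lt.le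

/-- `p` is the name of a node from which `k` receives, and which is at most `t` hops away from
`j`. -/
def IsParent {n : ℕ} (G : SimpleGraph (Fin n)) (R : ℕ) (j : Fin n) (t : ℕ) (k : Fin n) (p : ℕ) :
    Prop :=
  ∃ q : Fin n, p = q ∧ G.edist k q ≤ (R : ℕ∞) ∧ InHops G R j t q

/-- Up to level `t`, the parents of the nodes around `j` are one level closer to `j`. -/
def IsTree {n : ℕ} (G : SimpleGraph (Fin n)) (R : ℕ) (j : Fin n) (t : ℕ) (par : Fin n → ℕ) :
    Prop :=
  ∀ k, ∀ s ≤ t, InHops G R j s k → IsParent G R j (s - 1) k (par k)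

theorem IsParent.mono {n : ℕ} {G : SimpleGraph (Fin n)} {R : ℕ} {j k : Fin n} {s t p : ℕ}
    (h : IsParent G R j s k p) (hst : s ≤ t) : IsParent G R j t k p := by
  obtain ⟨q, h₁, h₂, h₃⟩ := h
  exact ⟨q, h₁, h₂, h₃.mono hst⟩

theorem received_eq {n : ℕ} {G : SimpleGraph (Fin n)} {R : ℕ} {out : Fin n → ℝ} {k q : Fin n}
    (h : G.edist k q ≤ (R : ℕ∞)) : received G R out k q = out q := by
  simp [received, h]

/-- Receive the flag of the node in register `7`; if it is new, that node becomes the parent. -/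
def searchStep : Cmd :=
  .seq (.op (.recv (scalar 5) 7))
    (.seq (.ite (.realLt (scalar 4) (scalar 5)) (.op (.idxAdd 8 7 3)) (.op .nop))
      (.seq (.ite (.realLt (scalar 4) (scalar 5)) (.op (.copy (scalar 4) (scalar 5))) (.op .nop))
        (.op (.idxAdd 7 7 4))))

def searchRound : Cmd :=
  .seq (.op (.send (scalar 4)))
    (.seq (.op (.idxConst 7 0)) (.seq (.loop (.idxLt 7 0) searchStep) (.op (.idxAdd 6 6 4))))

/-- Breadth-first search from the pivot node. -/
def search : Cmd :=
  .seq (.op (.idxAdd 8 1 3))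
    (.seq (.ite (.idxEq 1 5) (.op (.ofIdx (scalar 4) 4)) (.op (.ofIdx (scalar 4) 3)))
      (.seq (.op (.idxConst 6 0)) (.loop (.idxLt 6 0) searchRound)))

/-- Send the entry of the pivot row in the current column along the tree. -/
def broadcast : Cmd :=
  .seq (.ite (.idxEq 1 5) (.op (.copy (scalar 6) (entry 9))) (.op .nop))
    (.seq (.op (.idxConst 6 0))
      (.loop (.idxLt 6 0)
        (.seq (.op (.send (scalar 6))) (.seq (.op (.recv (scalar 6) 8)) (.op (.idxAdd 6 6 4))))))

section Search

variable {n : ℕ} (G : SimpleGraph (Fin n)) (R : ℕ) (j : Fin n) (A : Fin n → ℕ → ℝ)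

/-- `k` receives from a node with name less than `i` that is at most `t` hops away from `j`. -/
def Scanned (t i : ℕ) (k : Fin n) : Prop :=
  ∃ q : Fin n, (q : ℕ) < i ∧ G.edist k q ≤ (R : ℕ∞) ∧ InHops G R j t q

open Classical in
/-- The state of round `t` of the search from `j` after the nodes less than `i` were scanned. -/
structure ScanInv (t i : ℕ) (S : Vars n) : Prop where
  piv : S.piv = j
  row : S.row = A
  round : S.round = t
  scan : S.scan = i
  out : ∀ k, S.out k = if InHops G R j t k then 1 else 0
  flag : ∀ k, S.flag k = if InHops G R j t k ∨ Scanned G R j t i k then 1 else 0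
  tree : IsTree G R j t S.par
  new : ∀ k, ¬ InHops G R j t k → Scanned G R j t i k → IsParent G R j t k (S.par k)

open Classical in
/-- The state of the search from `j` after `t` rounds. -/
structure SearchInv (t : ℕ) (S : Vars n) : Prop where
  piv : S.piv = j
  row : S.row = A
  round : S.round = t
  flag : ∀ k, S.flag k = if InHops G R j t k then 1 else 0
  tree : IsTree G R j t S.par

theorem scanned_succ {t : ℕ} {q k : Fin n} : Scanned G R j t (q + 1) k ↔
    Scanned G R j t q k ∨ (G.edist k q ≤ (R : ℕ∞) ∧ InHops G R j t q) := by
  constructor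
  · rintro ⟨p, hp, h⟩
    rcases Nat.lt_succ_iff_lt_or_eq.1 hp with hp | hp
    · exact Or.inl ⟨p, hp, h⟩
    · obtain rfl : p = q := Fin.ext hp
      exact Or.inr h
  · rintro (⟨p, hp, h⟩ | h)
    · exact ⟨p, by omega, h⟩
    · exact ⟨q, by omega, h⟩

/-- The outgoing numbers are frozen during a round, so a node discovered in this round does not pass
the discovery on before the next one. -/
theorem hoare_searchStep (t : ℕ) (q : Fin n) :
    Hoare G R (ScanInv G R j A t q) searchStep 9 (ScanInv G R j A t (q + 1)) := by
  classical
  refine (hoare_recv_flag.seq (hoare_par_update.seq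
    (hoare_flag_update.seq hoare_scan_succ))).pre fun S h => ?_
  have hr : ∀ k, received G R S.out k S.scan =
      if G.edist k q ≤ (R : ℕ∞) ∧ InHops G R j t q then 1 else 0 := by
    intro k
    rw [h.scan]
    by_cases e : G.edist k q ≤ (R : ℕ∞)
    · rw [received_eq e, h.out]; simp [e]
    · simp [received, e]
  -- Both numbers are 0 or 1, so the strict inequality says that `k` is discovered now; known nodes
  -- keep their parents.
  have hlt : ∀ k, S.flag k < received G R S.out k S.scan ↔
      (¬ InHops G R j t k ∧ ¬ Scanned G R j t q k) ∧
        (G.edist k q ≤ (R : ℕ∞) ∧ InHops G R j t q) := by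
    intro k
    rw [hr, h.flag, ← not_or]
    split_ifs with h₁ h₂ h₂ <;> simp [h₁, h₂]
  constructor
  · exact h.piv
  · exact h.row
  · exact h.round
  · exact congrArg (· + 1) h.scan
  · exact h.out
  · intro k
    dsimp only
    simp only [hlt]
    rw [hr, h.flag, scanned_succ]
    split_ifs <;> first | rfl | tauto
  · intro k s hs hk
    dsimp only
    rw [if_neg]
    · exact h.tree k s hs hk
    · rw [hlt]
      exact fun h' => h'.1.1 (hk.mono hs)
  · intro k hk hsc
    dsimp only
    split_ifs with hc
    · obtain ⟨-, h₁, h₂⟩ := (hlt k).1 hc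
      exact ⟨q, h.scan, h₁, h₂⟩
    · refine h.new k hk ?_
      rw [hlt] at hc
      rw [scanned_succ] at hsc
      tauto

theorem hoare_searchRound {t : ℕ} :
    Hoare G R (SearchInv G R j A t) searchRound (10 * n + 7) (SearchInv G R j A (t + 1)) := by
  classical
  have hl := Hoare.loop (G := G) (R := R) (ScanInv G R j A t) n (x := 7) (y := 0) (c := searchStep)
    (B := 9) (fun i S h k s hs => ⟨hs.scan.trans h.scan, hs.size⟩)
    (fun i hi => hoare_searchStep G R j A t ⟨i, hi⟩)
  have hfin : ∀ S, ScanInv G R j A t n S →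
      SearchInv G R j A (t + 1) { S with round := S.round + 1 } := by
    intro S h
    have hsc : ∀ k, Scanned G R j t n k ↔ InHops G R j (t + 1) k := fun k =>
      ⟨fun ⟨q, _, h⟩ => ⟨q, h⟩, fun ⟨q, h⟩ => ⟨q, q.2, h⟩⟩
    refine ⟨h.piv, h.row, congrArg (· + 1) h.round, fun k => ?_, fun k s hs hk => ?_⟩
    · have e : InHops G R j t k ∨ Scanned G R j t n k ↔ InHops G R j (t + 1) k := by
        rw [hsc, or_iff_right_of_imp InHops.succ]
      simp only [h.flag k, e]
    · rcases Nat.le_succ_iff.1 hs with hs | rfl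
      · exact h.tree k s hs hk
      · by_cases h' : InHops G R j t k
        · exact (h.tree k t le_rfl h').mono (by omega)
        · exact h.new k h' ((hsc k).2 hk)
  refine (hoare_send_flag.seq (hoare_scan_init.seq (hl.seq (hoare_round_succ.pre hfin)))).consequence
    (fun S h => ?_) (fun S h => h) (by omega)
  have hsc : ∀ k, ¬ Scanned G R j t 0 k := fun k ⟨q, hq, _⟩ => by omega
  refine ⟨h.piv, h.row, h.round, rfl, h.flag, fun k => ?_, h.tree, fun k _ hk => (hsc k hk).elim⟩
  simpa [hsc] using h.flag k

theorem hoare_search :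
    Hoare G R (fun S => S.piv = j ∧ S.row = A) search (10 * n ^ 2 + 8 * n + 8)
      (fun S => S.piv = j ∧ S.row = A ∧ IsTree G R j n S.par) := by
  classical
  have hl := Hoare.loop (G := G) (R := R) (SearchInv G R j A) n (x := 6) (y := 0)
    (c := searchRound) (fun i S h k s hs => ⟨hs.round.trans h.round, hs.size⟩)
    (fun i _ => hoare_searchRound G R j A)
  refine (hoare_par_self.seq (hoare_flag_init.seq (hoare_round_init.seq hl))).consequence
    (fun S h => ?_) (fun S h => ⟨h.piv, h.row, h.tree⟩) (le_of_eq (by ring))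
  refine ⟨h.1, h.2, rfl, fun k => ?_, fun k s hs hk => ?_⟩
  · simp [InHops, h.1, Fin.ext_iff]
  -- Here `s - 1 = 0`: the pivot node is its own parent, so it retains its value in every broadcast.
  · obtain rfl : s = 0 := by omega
    exact ⟨k, rfl, by simp, hk⟩

/-- The values that do not change in a broadcast of column `c`, and the parents. -/
structure Frame (m : Fin n → ℝ) (c : ℕ) (S : Vars n) : Prop where
  piv : S.piv = j
  row : S.row = A
  tree : IsTree G R j n S.par
  mult : S.mult = m
  col : S.col = c

/-- In each round every node overwrites its value by that of its parent. A node within `t + 1` hops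
has a parent within `t` hops, so correct values spread and are never lost. -/
theorem hoare_broadcast (m : Fin n → ℝ) (c : ℕ) :
    Hoare G R (Frame G R j A m c) broadcast (6 * n + 6)
      (fun S => Frame G R j A m c S ∧ ∀ k, InHops G R j n k → S.val k = A j c) := by
  classical
  have hl := Hoare.loop (G := G) (R := R) (fun t S => Frame G R j A m c S ∧ S.round = t ∧
      ∀ k, InHops G R j t k → S.val k = A j c) n (x := 6) (y := 0)
    (fun i S h k s hs => ⟨hs.round.trans h.2.1, hs.size⟩)
    (fun t ht => (hoare_send_val.seq (hoare_recv_val.seq hoare_round_succ)).pre ?_)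
  · refine (hoare_val_init.seq (hoare_round_init.seq hl)).consequence
      (fun S h => ?_) (fun S h => ⟨h.1, h.2.2⟩) (le_of_eq (by ring))
    refine ⟨⟨h.piv, h.row, h.tree, h.mult, h.col⟩, rfl, fun k hk => ?_⟩
    obtain rfl : k = j := hk
    simp [h.piv, h.row, h.col]
  · rintro S ⟨h, hr, hv⟩
    refine ⟨⟨h.piv, h.row, h.tree, h.mult, h.col⟩, congrArg (· + 1) hr, fun k hk => ?_⟩
    obtain ⟨q, h₁, h₂, h₃⟩ := h.tree k (t + 1) ht hk
    dsimp only
    rw [h₁, received_eq h₂]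
    exact hv q h₃

end Search

/-! ### The elimination program -/

def updateColumn : Cmd :=
  .seq broadcast
    (.seq (.op (.arith (scalar 8) .mul (scalar 7) (scalar 6)))
      (.seq (.op (.arith (entry 9) .sub (entry 9) (scalar 8))) (.op (.idxAdd 9 9 4))))

/-- Eliminate the pivot column from the rows of the other nodes. -/
def eliminate : Cmd :=
  .seq search
    (.seq (.op (.idxAdd 9 5 3))
      (.seq broadcast
        (.seq (.ite (.idxEq 1 5) (.op (.ofIdx (scalar 7) 3))
            (.op (.arith (scalar 7) .div (entry 5) (scalar 6))))
          (.seq (.op (.idxConst 9 0))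
            (.seq (.loop (.idxLt 9 10) updateColumn) (.op (.idxAdd 5 5 4)))))))

/-- Set the constants and append the right-hand side to the row. -/
def prepare : Cmd :=
  .seq (.op (.idxConst 4 1)) (.seq (.op (.idxAdd 10 0 4)) (.op (.copy (entry 0) ⟨1, 3, 3⟩)))

/-- Distributed Gauss–Jordan elimination. -/
def gaussJordan : Cmd :=
  .seq prepare
    (.seq (.loop (.idxLt 5 0) eliminate) (.op (.arith ⟨3, 3, 3⟩ .div (entry 0) (entry 1))))

/-! ### Correctness and cost of one elimination step -/

section Eliminate

variable {n : ℕ} (G : SimpleGraph (Fin n)) (R : ℕ) (j : Fin n) (A : Fin n → ℕ → ℝ)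

/-- The rows after the elimination of the columns less than `c` with the multipliers `m`. -/
noncomputable def partialRow (m : Fin n → ℝ) (c : ℕ) (k : Fin n) (l : ℕ) : ℝ :=
  if l < c then A k l - m k * A j l else A k l

/-- Nodes that the broadcast does not reach may hold an arbitrary value, but their multiplier is 0.
-/
theorem hoare_updateColumn (m : Fin n → ℝ) (hm : ∀ k, m k ≠ 0 → InHops G R j n k) (c : ℕ) :
    Hoare G R (Frame G R j (partialRow j A m c) m c) updateColumn (6 * n + 12)
      (Frame G R j (partialRow j A m (c + 1)) m (c + 1)) := by
  refine ((hoare_broadcast G R j (partialRow j A m c) m c).seq ((hoare_prod.seq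
    (hoare_row_update.seq hoare_col_succ)).pre ?_)).consequence
      (fun _ h => h) (fun _ h => h) (by omega)
  rintro S ⟨h, hv⟩
  refine ⟨h.piv, ?_, h.tree, h.mult, congrArg (· + 1) h.col⟩
  funext k l
  have hp : m k * S.val k = m k * A j c := by
    by_cases h0 : m k = 0
    · rw [h0, zero_mul, zero_mul]
    -- Column `c` is still untouched, so the entry sent is the original `A j c`.
    · rw [hv k (hm k h0), partialRow, if_neg (lt_irrefl c)]
  dsimp only
  rw [h.mult, h.col, h.row, hp, Function.update_apply]
  unfold partialRow
  rcases lt_trichotomy l c with e | rfl | e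
  · rw [if_neg e.ne, if_pos e, if_pos (by omega)]
  · simp
  · rw [if_neg e.ne', if_neg (by omega), if_neg (by omega)]

theorem hoare_eliminate (hA : ∀ k, A k j ≠ 0 → InHops G R j n k) :
    Hoare G R (fun S => S.piv = j ∧ S.row = A) eliminate (16 * n ^ 2 + 33 * n + 39)
      (fun S => S.piv = j + 1 ∧ ∀ k, ∀ c ≤ n,
        S.row k c = A k c - multiplier (fun k l => A k l) j k * A j c) := by
  set m := multiplier (fun k l => A k l) j with hm
  have hmA : ∀ k, m k ≠ 0 → InHops G R j n k := by
    intro k hk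
    refine hA k ?_
    rintro e
    simp [hm, multiplier, e] at hk
  have hl := Hoare.loop (G := G) (R := R) (fun c => Frame G R j (partialRow j A m c) m c) (n + 1)
    (x := 9) (y := 10) (fun i S h k s hs => ⟨hs.col.trans h.col, hs.width⟩)
    (fun c _ => hoare_updateColumn G R j A m hmA c)
  have hend : ∀ S, Frame G R j (partialRow j A m (n + 1)) m (n + 1) S →
      S.piv + 1 = j + 1 ∧ ∀ k, ∀ c ≤ n, S.row k c = A k c - m k * A j c := by
    intro S h
    refine ⟨by rw [h.piv], fun k c hc => ?_⟩
    rw [h.row, partialRow, if_pos (by omega)]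
  have hmid : ∀ m₀ S, (Frame G R j A m₀ j S ∧ ∀ k, InHops G R j n k → S.val k = A j j) →
      Frame G R j (partialRow j A m 0) m 0 { S with
        mult := fun k => if (k : ℕ) = S.piv then 0 else S.row k S.piv / S.val k
        col := 0 } := by
    rintro m₀ S ⟨h, hv⟩
    refine ⟨h.piv, ?_, h.tree, ?_, rfl⟩
    · funext k l
      simp [partialRow, h.row]
    · funext k
      simp only [hm, multiplier, h.piv, h.row, Fin.ext_iff]
      congr 1
      -- If `A k j = 0`, the quotient is 0 whatever the node received.
      by_cases h0 : A k j = 0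
      · rw [h0, zero_div, zero_div]
      · rw [hv k (hA k h0)]
  have hsucc := (hoare_piv_succ (G := G) (R := R) (Q := fun S => S.piv = j + 1 ∧
    ∀ k, ∀ c ≤ n, S.row k c = A k c - m k * A j c)).pre hend
  -- The first broadcast runs with leftover multipliers `m₀`, about which nothing is known.
  have hb : Hoare G R (fun S => ∃ m₀, Frame G R j A m₀ j S) _ _ _ :=
    Hoare.exists fun m₀ => (hoare_broadcast G R j A m₀ j).seq
      ((hoare_mult.seq (hoare_col_init.seq
        (hl.seq hsucc))).pre (hmid m₀))
  refine ((hoare_search G R j A).seq ((hoare_col_piv.seq hb).pre ?_)).consequence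
    (fun _ h => h) (fun _ h => h) (by nlinarith)
  rintro S ⟨h₁, h₂, h₃⟩
  exact ⟨S.mult, h₁, h₂, h₃, rfl, h₁⟩

end Eliminate

/-! ### Initialisation and the complete run -/

/-- The initial values after `prepare`. -/
noncomputable def initVars {n : ℕ} (M : Matrix (Fin n) (Fin n) ℝ) (b : Fin n → ℝ) : Vars n where
  piv := 0
  round := 0
  scan := 0
  col := 0
  par _ := 0
  row k c := if h : c < n then M k ⟨c, h⟩ else if c = n then b k else 0
  flag _ := 0
  recd _ := 0
  val _ := 0
  mult _ := 0
  prod _ := 0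
  out _ := 0

theorem lockstep_prepare {n : ℕ} (G : SimpleGraph (Fin n)) (M : Matrix (Fin n) (Fin n) ℝ)
    (b : Fin n → ℝ) (R : ℕ) (ε : ℝ) (P : Cmd) :
    Lockstep G R (fun σ => σ = fun k => initNode P R ε k (M k) (b k)) prepare 7
      (fun σ => Stores (initVars M b) σ) := by
  refine (Lockstep.seq (Lockstep.op (fun σ h => h)) (Lockstep.seq (Lockstep.op (fun σ h => h))
    (Lockstep.op (fun σ h => h)))).consequence ?_ (fun _ h => h) (by norm_num)
  rintro σ rfl k
  constructor
  case row =>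
    intro c
    by_cases hc : c = n
    · simp [Op.exec, Node.put, Node.setIdx, Node.get, initNode, initVars, hc]
    · by_cases h' : c < n <;>
        simp [Op.exec, Node.put, Node.setIdx, initNode, initVars, hc, h']
  all_goals simp [Op.exec, Node.put, Node.setIdx, initNode, initVars]

theorem lockstep_gaussJordan {n : ℕ} {M : Matrix (Fin n) (Fin n) ℝ} {b : Fin n → ℝ} {R : ℕ}
    (hM : IsWeightedLaplacian M) (hb : ∃ x : Fin n → ℝ, M.mulVec x = b) (hR : 1 ≤ R) (ε : ℝ)
    (P : Cmd) :
    Lockstep (graph M) R (fun σ => σ = fun k => initNode P R ε k (M k) (b k)) gaussJordan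
      (16 * n ^ 3 + 33 * n ^ 2 + 40 * n + 11)
      (fun σ => M.mulVec (fun k => (σ k).result) = b) := by
  have hl := Hoare.loop (G := graph M) (R := R) (fun p S => S.piv = p ∧
      Eliminated M b p (fun k l => S.row k l) (fun k => S.row k n)) n (x := 5) (y := 0)
    (c := eliminate) (B := 16 * n ^ 2 + 33 * n + 39)
    (fun i S h k s hs => ⟨hs.piv.trans h.1, hs.size⟩) (fun p hp => ?_)
  · refine ((lockstep_prepare (graph M) M b R ε P).seq
      ((Lockstep.seq hl (Lockstep.op ?_)).consequence ?_ (fun _ h => h) le_rfl)).consequence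
        (fun _ h => h) (fun _ h => h) (le_of_eq (by ring))
    · rintro σ ⟨S, hS, -, h⟩
      convert h.solution hb using 3 with k
      have hk := hS k
      simp [Op.exec, Node.result, Node.put, Node.get, Arith.eval, hk.zero, hk.size, hk.name,
        hk.row]
    · intro σ hσ
      refine ⟨_, hσ, rfl, ?_⟩
      have h₁ : (fun k (l : Fin n) => (initVars M b).row k l) = M := by
        funext k l
        simp [initVars]
      have h₂ : (fun k => (initVars M b).row k n) = b := by
        funext k
        simp [initVars]
      rw [h₁, h₂]
      exact hM.eliminated_zero b
  · refine (Hoare.exists (P := fun (A : {A : Fin n → ℕ → ℝ // Eliminated M b p (fun k l => A k l)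
      (fun k => A k n)}) S => S.piv = p ∧ S.row = A) fun A => ?_).pre
        (fun S h => ⟨⟨S.row, h.2⟩, h.1, rfl⟩)
    obtain ⟨A, hA⟩ := A
    -- Non-zero entries stay within components, so every row to be changed belongs to a node
    -- reachable from the pivot node.
    refine (hoare_eliminate (graph M) R ⟨p, hp⟩ A fun k hk =>
      InHops.of_reachable hR (hA.comp k ⟨p, hp⟩ hk)).consequence (fun _ h => h) ?_ le_rfl
    rintro S ⟨h₁, h₂⟩
    refine ⟨h₁, ?_⟩
    simp only [h₂ _ _ le_rfl, h₂ _ _ (Fin.is_lt _).le]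
    exact Eliminated.step (j := ⟨p, hp⟩) hA

end RHop

theorem corollary1 :
    ∃ (P : RHop.Cmd) (C : ℝ), 0 < C ∧
      ∀ (n R : ℕ) (M : Matrix (Fin n) (Fin n) ℝ) (b : Fin n → ℝ) (ε : ℝ),
        RHop.IsWeightedLaplacian M →
        (∃ i j, (RHop.graph M).Adj i j) →
        (∃ x : Fin n → ℝ, M.mulVec x = b) →
        1 ≤ R → R ≤ n →
        0 < ε → ε ≤ 1 / 2 →
        ∃ T : ℕ,
          (T : ℝ) ≤ C * ((n : ℝ) ^ 3 * (RHop.hopBound M R : ℝ) / (R : ℝ) *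
            (RHop.maxWeight M / RHop.minWeight M) * Real.log (1 / ε)) ∧
          (∀ k, (RHop.run P M b R ε T k).Halted) ∧
          RHop.IsApproxSolution M b ε (fun k => (RHop.run P M b R ε T k).result) := by
  -- The coefficients of the running time sum to `16 + 33 + 40 + 11 = 100`; `cube_le_bound` costs
  -- another factor 2.
  refine ⟨RHop.gaussJordan, 200, by norm_num, ?_⟩
  intro n R M b ε hM hedge hb hR hRn hε hε'
  obtain ⟨T, hT, σ, hσ, hrun⟩ :=
    RHop.lockstep_gaussJordan hM hb hR ε RHop.gaussJordan _ rfl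
  have hfin : RHop.run RHop.gaussJordan M b R ε T = RHop.withCode σ [] := hrun []
  refine ⟨T, ?_, fun k => by rw [hfin]; rfl, ?_⟩
  · have hn : 1 ≤ n := hR.trans hRn
    have h₁ : T ≤ 100 * n ^ 3 := by
      have h₂ : n ≤ n ^ 3 := Nat.le_self_pow (by norm_num) n
      have h₃ : n ^ 2 ≤ n ^ 3 := Nat.pow_le_pow_right hn (by norm_num)
      omega
    have h₄ : (T : ℝ) ≤ 100 * (n : ℝ) ^ 3 := by exact_mod_cast h₁
    linarith [RHop.cube_le_bound hedge hR hRn hε hε']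
  · refine RHop.isApproxSolution_of_mulVec_eq hε.le ?_
    rw [hfin]
    exact hσ
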